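/- Let $d\ge 2$ be an integer. Let $\mathbf t=t_0t_1t_2\cdots$ be the $d$-bonacci word, i.e. the unique infinite word over the alphabet $\{0,1,\ldots,d-1\}$ that is fixed by the morphism $\tau$ given by $\tau(a)=0(a+1)$ for $0\le a\le d-2$ and $\tau(d-1)=0$. Let $(D_k)$ be the sequence of $d$-bonacci numbers: $D_k=2^k$ for $0\le k\le d-1$ and $D_k=\sum_{j=1}^{d}D_{k-j}$ for $k\ge d$, with the convention $D_{-1}=1$ and $D_{-k}=0$ for $k=2,\ldots,d$. For $n\in\mathbb N$ let $$inr\mathcal C_{\mathbf t}(n)=\max\{m\in\mathbb N:\ t_i\cdots t_{i+n-1}\neq t_j\cdots t_{j+n-1}\ \text{ for all } i,j \text{ with } 0\le i<j\le m-1\}$$ be the initial non-repetitive complexity of $\mathbf t$. If $n,k$ are positive integers such that $$\frac{1}{d-1}\sum_{i=0}^{d-1}(d-i)D_{k-i-2}-\frac{d}{d-1}<n\le\frac{1}{d-1}\sum_{i=0}^{d-1}(d-i)D_{k-i-1}-\frac{d}{d-1},$$ then $inr\mathcal C_{\mathbf t}(n)=D_k$. -/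

import Mathlib

/-- The factor `u_i u_{i+1} ⋯ u_{i+n-1}` of length `n` occurring at position `i` in the
infinite word `u`. -/
def wordFactor {α : Type*} (u : ℕ → α) (n i : ℕ) : List α :=
  (List.range n).map fun l => u (i + l)

/-- The set of all `m` such that the factors of length `n` at the positions `0, …, m - 1` of `u`
are pairwise distinct. -/
def initialNonrepetitiveSet {α : Type*} (u : ℕ → α) (n : ℕ) : Set ℕ :=
  {m | ∀ i j : ℕ, i < j → j < m → wordFactor u n i ≠ wordFactor u n j}

/-- The initial non-repetitive complexity of `u`: the maximum of `initialNonrepetitiveSet u n`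
(the maximum exists whenever the alphabet is finite, see
`isGreatest_initialNonrepetitiveComplexity`). -/
noncomputable def initialNonrepetitiveComplexity {α : Type*} (u : ℕ → α) (n : ℕ) : ℕ :=
  sSup (initialNonrepetitiveSet u n)

theorem isGreatest_initialNonrepetitiveComplexity {α : Type*} [Finite α] (u : ℕ → α) (n : ℕ) :
    IsGreatest (initialNonrepetitiveSet u n) (initialNonrepetitiveComplexity u n) := by
  have hbdd : BddAbove (initialNonrepetitiveSet u n) := by
    obtain ⟨i, j, hne, h⟩ := Finite.exists_ne_map_eq_of_infinite
      (fun (i : ℕ) (l : Fin n) => u (i + l))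
    have key : ∀ i j : ℕ, i < j →
        (fun l : Fin n => u (i + l)) = (fun l : Fin n => u (j + l)) →
        BddAbove (initialNonrepetitiveSet u n) := by
      intro i j hij h
      refine ⟨j, fun m hm => ?_⟩
      by_contra hlt
      refine hm i j hij (by omega) ?_
      refine List.map_congr_left fun l hl => ?_
      exact congrFun h ⟨l, List.mem_range.1 hl⟩
    rcases lt_or_gt_of_ne hne with hlt | hlt
    · exact key i j hlt h
    · exact key j i hlt h.symm
  have hne : (initialNonrepetitiveSet u n).Nonempty :=
    ⟨0, fun i j _ h => absurd h (Nat.not_lt_zero j)⟩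
  exact ⟨Nat.sSup_mem hne hbdd, fun m hm => le_csSup hbdd hm⟩

/-- The `d`-bonacci morphism on letters of the alphabet `{0, …, d - 1}`:
`a ↦ 0 (a + 1)` for `a ≤ d - 2`, and `d - 1 ↦ 0`. -/
def bonacciMorphism (d : ℕ) (a : Fin d) : List (Fin d) :=
  if h : (a : ℕ) + 1 < d then [⟨0, a.pos⟩, ⟨(a : ℕ) + 1, h⟩] else [⟨0, a.pos⟩]

/-- The infinite word `u` is a fixed point of the (non-erasing) morphism given on letters by `τ`:
the image of every prefix of `u` is again a prefix of `u`. -/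
def IsMorphismFixedPoint {α : Type*} (τ : α → List α) (u : ℕ → α) : Prop :=
  ∀ n : ℕ, (wordFactor u n 0).flatMap τ = wordFactor u ((wordFactor u n 0).flatMap τ).length 0

/-- The infinite word `t` over `{0, …, d - 1}` is the `d`-bonacci word (for `2 ≤ d` there is exactly
one such word, see `existsUnique_isBonacciWord`). -/
def IsBonacciWord (d : ℕ) (t : ℕ → Fin d) : Prop :=
  IsMorphismFixedPoint (bonacciMorphism d) t

/-- The `d`-bonacci numbers: `D_k = 2 ^ k` for `k < d`, and
`D_k = D_{k-1} + ⋯ + D_{k-d}` for `k ≥ d`. -/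
def bonacciNat (d : ℕ) (k : ℕ) : ℕ :=
  if k < d then 2 ^ k else ∑ j : Fin d, bonacciNat d (k - ((j : ℕ) + 1))
termination_by k
decreasing_by
  have := j.isLt
  omega

/-- The `d`-bonacci numbers with the convention `D_{-1} = 1` and `D_{-k} = 0` for `k ≥ 2`. -/
def bonacciNumber (d : ℕ) : ℤ → ℕ
  | Int.ofNat k => bonacciNat d k
  | Int.negSucc 0 => 1
  | Int.negSucc (_ + 1) => 0

section BonacciWord

theorem length_flatMap_bonacci {d : ℕ} (w : List (Fin d)) :
    w.length ≤ (w.flatMap (bonacciMorphism d)).length := by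
  induction w with
  | nil => simp
  | cons a w ih =>
    have : 1 ≤ (bonacciMorphism d a).length := by
      unfold bonacciMorphism
      split_ifs <;> simp
    simp only [List.flatMap_cons, List.length_append, List.length_cons]
    omega

/-- `bonacciIter d hd n` is the `n`-th iterate of the morphism at the letter `0`. -/
def bonacciIter (d : ℕ) (hd : 2 ≤ d) : ℕ → List (Fin d)
  | 0 => [⟨0, by omega⟩]
  | n + 1 => (bonacciIter d hd n).flatMap (bonacciMorphism d)

theorem bonacciIter_spec (d : ℕ) (hd : 2 ≤ d) (n : ℕ) :
    n + 1 ≤ (bonacciIter d hd n).length ∧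
      ∃ w, bonacciIter d hd n = ⟨0, by omega⟩ :: w := by
  induction n with
  | zero => exact ⟨by simp [bonacciIter], [], rfl⟩
  | succ n ih =>
    obtain ⟨h1, w, hw⟩ := ih
    have h0 : bonacciMorphism d ⟨0, by omega⟩ = [⟨0, by omega⟩, ⟨1, by omega⟩] := by
      unfold bonacciMorphism
      rw [dif_pos (by simp; omega)]
    have hs : bonacciIter d hd (n + 1) =
        ⟨0, by omega⟩ :: ⟨1, by omega⟩ :: w.flatMap (bonacciMorphism d) := by
      simp [bonacciIter, hw, h0]
    refine ⟨?_, _, hs⟩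
    have := length_flatMap_bonacci w
    rw [hw] at h1
    rw [hs]
    simp only [List.length_cons] at h1 ⊢
    omega

theorem bonacciIter_prefix_succ (d : ℕ) (hd : 2 ≤ d) (n : ℕ) :
    bonacciIter d hd n <+: bonacciIter d hd (n + 1) := by
  induction n with
  | zero =>
    obtain ⟨-, w, hw⟩ := bonacciIter_spec d hd 1
    rw [hw]
    exact ⟨w, rfl⟩
  | succ n ih =>
    obtain ⟨s, hs⟩ := ih
    refine ⟨s.flatMap (bonacciMorphism d), ?_⟩
    change (bonacciIter d hd n).flatMap (bonacciMorphism d) ++ _ =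
      (bonacciIter d hd (n + 1)).flatMap (bonacciMorphism d)
    rw [← hs, List.flatMap_append]

theorem bonacciIter_prefix (d : ℕ) (hd : 2 ≤ d) {m n : ℕ} (h : m ≤ n) :
    bonacciIter d hd m <+: bonacciIter d hd n := by
  induction n, h using Nat.le_induction with
  | base => exact List.prefix_rfl
  | succ n _ ih => exact ih.trans (bonacciIter_prefix_succ d hd n)

theorem eq_wordFactor {α : Type*} {u : ℕ → α} {w : List α}
    (h : ∀ i (hi : i < w.length), w[i] = u i) : w = wordFactor u w.length 0 := by
  apply List.ext_getElem
  · simp [wordFactor]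
  · intro i h1 h2
    simp [wordFactor, h i h1]

theorem wordFactor_append {α : Type*} (u : ℕ → α) (m n : ℕ) :
    wordFactor u m 0 <+: wordFactor u (m + n) 0 := by
  unfold wordFactor
  rw [List.range_add, List.map_append]
  exact List.prefix_append _ _

theorem existsUnique_isBonacciWord (d : ℕ) (hd : 2 ≤ d) :
    ∃! t : ℕ → Fin d, IsBonacciWord d t := by
  have hlt : ∀ n, n < (bonacciIter d hd n).length := fun n => (bonacciIter_spec d hd n).1
  refine ⟨fun n => (bonacciIter d hd n)[n]'(hlt n), ?_, ?_⟩
  · set t : ℕ → Fin d := fun n => (bonacciIter d hd n)[n]'(hlt n) with ht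
    have hpre : ∀ n, bonacciIter d hd n = wordFactor t (bonacciIter d hd n).length 0 := by
      intro n
      refine eq_wordFactor fun i hi => ?_
      rcases le_total i n with h | h
      · exact ((bonacciIter_prefix d hd h).getElem (hlt i)).symm
      · exact (bonacciIter_prefix d hd h).getElem hi
    intro n
    have h1 : wordFactor t n 0 <+: bonacciIter d hd n := by
      rw [hpre n]
      obtain ⟨c, hc⟩ := Nat.exists_eq_add_of_le (hlt n).le
      rw [hc]
      exact wordFactor_append t n c
    have h2 : (wordFactor t n 0).flatMap (bonacciMorphism d) <+: bonacciIter d hd (n + 1) := by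
      obtain ⟨s, hs⟩ := h1
      refine ⟨s.flatMap (bonacciMorphism d), ?_⟩
      change _ = (bonacciIter d hd n).flatMap (bonacciMorphism d)
      rw [← hs, List.flatMap_append]
    refine eq_wordFactor fun i hi => ?_
    have h3 := h2.getElem hi
    rw [h3]
    have h4 : ∀ (w : List (Fin d)) (hi : i < w.length), w = wordFactor t w.length 0 →
        w[i] = t i := by
      intro w hi hw
      have : w[i]? = (wordFactor t w.length 0)[i]? := by rw [← hw]
      simpa [wordFactor, hi] using this
    exact h4 _ _ (hpre (n + 1))
  · intro t ht
    have h0 : t 0 = ⟨0, by omega⟩ := by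
      have h := ht 1
      have h' : (wordFactor t 1 0).flatMap (bonacciMorphism d) = bonacciMorphism d (t 0) := by
        simp [wordFactor]
      rw [h'] at h
      have h2 : (bonacciMorphism d (t 0))[0]? =
          (wordFactor t (bonacciMorphism d (t 0)).length 0)[0]? := by rw [← h]
      unfold bonacciMorphism at h2
      split_ifs at h2 <;> simpa [wordFactor, eq_comm] using h2
    have hpre : ∀ n, bonacciIter d hd n = wordFactor t (bonacciIter d hd n).length 0 := by
      intro n
      induction n with
      | zero => simp [bonacciIter, wordFactor, h0]
      | succ n ih =>
        have h := ht (bonacciIter d hd n).length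
        rw [← ih] at h
        exact h
    funext n
    have h2 : (bonacciIter d hd n)[n]? =
        (wordFactor t (bonacciIter d hd n).length 0)[n]? := by rw [← hpre n]
    have := hlt n
    simpa [wordFactor, this, eq_comm] using h2

end BonacciWord

/-! Put `S_k = D_0 + ⋯ + D_{k-1}`. The two rational bounds equal `S_{k-1}` and `S_k`
(`weighted_sum_bonacciNumber`). The prefix of length `S_k` recurs at position `D_k`
(`IsBonacciWord.bonacciNat_period`), so for `n ≤ S_k` the complexity is at most `D_k`. Conversely,
factors starting at `i < j` differ at some offset `p ≤ S_m` with `D_m ≤ j`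
(`IsBonacciWord.exists_mismatch`); `j < D_k` forces `m ≤ k - 1`, so length `n > S_{k-1}` separates
them. Both facts come from desubstitution: `t` is cut into blocks `τ(t m)`, block `m` starting at
`imageLength t m`, and agreement of length `S_m` becomes agreement of length `S_{m+1}` under the
morphism. -/

/-! ### Block structure of the word. -/

/-- The length of the image under the `d`-bonacci morphism of the prefix of `t` of length `m`. -/
def imageLength {d : ℕ} (t : ℕ → Fin d) (m : ℕ) : ℕ :=
  ((wordFactor t m 0).flatMap (bonacciMorphism d)).length

theorem wordFactor_zero_succ {α : Type*} (u : ℕ → α) (m : ℕ) :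
    wordFactor u (m + 1) 0 = wordFactor u m 0 ++ [u m] := by
  simp [wordFactor, List.range_succ]

theorem wordFactor_eq_iff {α : Type*} (u : ℕ → α) (n i j : ℕ) :
    wordFactor u n i = wordFactor u n j ↔ ∀ l < n, u (i + l) = u (j + l) := by
  simp [wordFactor]

theorem imageLength_zero {d : ℕ} (t : ℕ → Fin d) : imageLength t 0 = 0 := by
  simp [imageLength, wordFactor]

theorem imageLength_succ {d : ℕ} (t : ℕ → Fin d) (m : ℕ) :
    imageLength t (m + 1) = imageLength t m + if (t m : ℕ) + 1 < d then 2 else 1 := by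
  unfold imageLength
  rw [wordFactor_zero_succ, List.flatMap_append, List.length_append]
  simp only [List.flatMap_singleton, bonacciMorphism]
  split_ifs <;> rfl

theorem imageLength_strictMono {d : ℕ} (t : ℕ → Fin d) : StrictMono (imageLength t) := by
  refine strictMono_nat_of_lt_succ fun m => ?_
  rw [imageLength_succ]
  split_ifs <;> omega

theorem IsBonacciWord.getElem?_image {d : ℕ} {t : ℕ → Fin d} (ht : IsBonacciWord d t)
    (m r : ℕ) (hr : r < (bonacciMorphism d (t m)).length) :
    (bonacciMorphism d (t m))[r]? = some (t (imageLength t m + r)) := by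
  have h := ht (m + 1)
  rw [wordFactor_zero_succ, List.flatMap_append, List.length_append] at h
  have h2 := congrArg (fun w => w[imageLength t m + r]?) h
  simp only [List.flatMap_singleton] at h2
  rw [List.getElem?_append_right (by simp [imageLength])] at h2
  have h3 : imageLength t m + r -
      ((wordFactor t m 0).flatMap (bonacciMorphism d)).length = r := by
    simp [imageLength]
  rw [h3] at h2
  rw [h2, wordFactor, List.getElem?_map, List.getElem?_range (by simp only [imageLength]; omega)]
  simp

theorem IsBonacciWord.apply_imageLength {d : ℕ} {t : ℕ → Fin d} (ht : IsBonacciWord d t)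
    (m : ℕ) : (t (imageLength t m) : ℕ) = 0 := by
  have h := ht.getElem?_image m 0 (by unfold bonacciMorphism; split_ifs <;> simp)
  unfold bonacciMorphism at h
  split_ifs at h <;> simp at h <;> rw [← h]

theorem IsBonacciWord.apply_imageLength_add_one {d : ℕ} {t : ℕ → Fin d} (ht : IsBonacciWord d t)
    (m : ℕ) : (t (imageLength t m + 1) : ℕ) = if (t m : ℕ) + 1 < d then (t m : ℕ) + 1 else 0 := by
  split_ifs with hm
  · have h := ht.getElem?_image m 1 (by simp [bonacciMorphism, hm])
    simp only [bonacciMorphism, hm, dif_pos] at h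
    simp at h
    rw [← h]
  · have h := ht.apply_imageLength (m + 1)
    rwa [imageLength_succ, if_neg hm] at h

theorem exists_imageLength {d : ℕ} (t : ℕ → Fin d) (i : ℕ) :
    ∃ m, i = imageLength t m ∨ (i = imageLength t m + 1 ∧ (t m : ℕ) + 1 < d) := by
  induction i with
  | zero => exact ⟨0, Or.inl (imageLength_zero t).symm⟩
  | succ i ih =>
    obtain ⟨m, h | ⟨h, hm⟩⟩ := ih
    · by_cases hm : (t m : ℕ) + 1 < d
      · exact ⟨m, Or.inr ⟨by omega, hm⟩⟩
      · exact ⟨m + 1, Or.inl (by rw [imageLength_succ, if_neg hm, h])⟩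
    · exact ⟨m + 1, Or.inl (by rw [imageLength_succ, if_pos hm, h])⟩

theorem IsBonacciWord.exists_of_apply_eq_zero {d : ℕ} {t : ℕ → Fin d} (ht : IsBonacciWord d t)
    {i : ℕ} (hi : (t i : ℕ) = 0) : ∃ m, i = imageLength t m := by
  obtain ⟨m, h | ⟨h, hm⟩⟩ := exists_imageLength t i
  · exact ⟨m, h⟩
  · rw [h, ht.apply_imageLength_add_one, if_pos hm] at hi
    omega

theorem IsBonacciWord.exists_of_apply_ne_zero {d : ℕ} {t : ℕ → Fin d} (ht : IsBonacciWord d t)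
    {i : ℕ} (hi : (t i : ℕ) ≠ 0) : ∃ r, i = r + 1 ∧ (t r : ℕ) = 0 := by
  obtain ⟨m, h | ⟨h, hm⟩⟩ := exists_imageLength t i
  · exact absurd (h ▸ ht.apply_imageLength m) hi
  · exact ⟨_, h, ht.apply_imageLength m⟩

theorem imageLength_add {d : ℕ} {t : ℕ → Fin d} {i p : ℕ} (h : ∀ l < p, t (i + l) = t l) :
    imageLength t (i + p) = imageLength t i + imageLength t p := by
  induction p with
  | zero => simp [imageLength_zero]
  | succ p ih =>
    rw [← add_assoc, imageLength_succ, imageLength_succ, ih fun l hl => h l (by omega),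
      h p (by omega), add_assoc]

/-- Every block begins with `0`, so the agreement survives one letter past the image of the common
factor; hence `r ≤`, not `r <`. -/
theorem IsBonacciWord.apply_imageLength_add {d : ℕ} {t : ℕ → Fin d} (ht : IsBonacciWord d t)
    {i p : ℕ} (h : ∀ l < p, t (i + l) = t l) {r : ℕ} (hr : r ≤ imageLength t p) :
    t (imageLength t i + r) = t r := by
  have hadd : ∀ q ≤ p, imageLength t (i + q) = imageLength t i + imageLength t q :=
    fun q hq => imageLength_add fun l hl => h l (by omega)
  apply Fin.ext
  obtain ⟨q, rfl | ⟨rfl, -⟩⟩ := exists_imageLength t r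
  · rw [← hadd q ((imageLength_strictMono t).le_iff_le.1 hr), ht.apply_imageLength,
      ht.apply_imageLength]
  · have hq : q < p := (imageLength_strictMono t).lt_iff_lt.1 hr
    rw [← add_assoc, ← hadd q hq.le, ht.apply_imageLength_add_one,
      ht.apply_imageLength_add_one, h q hq]

/-- The last letter of a block is `a + 1` mod `d`, so it determines `a`. -/
theorem IsBonacciWord.apply_of_succ_eq_imageLength {d : ℕ} {t : ℕ → Fin d}
    (ht : IsBonacciWord d t) {m i : ℕ} (h : i + 1 = imageLength t (m + 1)) :
    (t i : ℕ) = if (t m : ℕ) + 1 < d then (t m : ℕ) + 1 else 0 := by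
  rw [imageLength_succ] at h
  split_ifs at h ⊢ with hm
  · obtain rfl : i = imageLength t m + 1 := by omega
    rw [ht.apply_imageLength_add_one, if_pos hm]
  · obtain rfl : i = imageLength t m := by omega
    exact ht.apply_imageLength m

/-! ### Lengths of iterates and `d`-bonacci numbers. -/

/-- The length of the `k`-th iterate of the `d`-bonacci morphism at the letter `a`. -/
def iterLength (d : ℕ) : ℕ → ℕ → ℕ
  | 0, _ => 1
  | k + 1, a => iterLength d k 0 + if a + 1 < d then iterLength d k (a + 1) else 0

theorem iterLength_of_lt (d k a : ℕ) (h : k + a < d) : iterLength d k a = 2 ^ k := by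
  induction k generalizing a with
  | zero => rfl
  | succ k ih =>
    rw [iterLength, if_pos (by omega), ih 0 (by omega), ih (a + 1) (by omega)]
    ring

/-- Unfold `τ^k(a) = τ^{k-1}(0) τ^{k-1}(a+1)` until the letter `d - 1` is reached, after `b` steps.
-/
theorem iterLength_of_le (d k b a : ℕ) (h : a + b + 1 = d) (hk : b + 1 ≤ k) :
    iterLength d k a = ∑ j ∈ Finset.range (b + 1), iterLength d (k - (j + 1)) 0 := by
  induction b generalizing k a with
  | zero =>
    obtain ⟨k, rfl⟩ := Nat.exists_eq_add_of_le' hk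
    simp [iterLength, show ¬ a + 1 < d by omega]
  | succ b ih =>
    obtain ⟨k, rfl⟩ := Nat.exists_eq_add_of_le' (show 1 ≤ k by omega)
    rw [iterLength, if_pos (by omega), ih k (a + 1) (by omega) (by omega),
      Finset.sum_range_succ' _ (b + 1), add_comm]
    congr 1
    refine Finset.sum_congr rfl fun j _ => ?_
    congr 1
    omega

theorem iterLength_zero_eq_bonacciNat (d : ℕ) (hd : 2 ≤ d) (k : ℕ) :
    iterLength d k 0 = bonacciNat d k := by
  induction k using Nat.strong_induction_on with
  | _ k ih =>
    rw [bonacciNat]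
    split_ifs with h
    · exact iterLength_of_lt d k 0 (by omega)
    · rw [iterLength_of_le d k (d - 1) 0 (by omega) (by omega), Nat.sub_add_cancel (by omega),
        Finset.sum_range]
      exact Finset.sum_congr rfl fun j _ => ih _ (by omega)

theorem sum_iterLength_flatMap (d k : ℕ) (w : List (Fin d)) :
    ((w.flatMap (bonacciMorphism d)).map fun a : Fin d => iterLength d k a).sum =
      (w.map fun a : Fin d => iterLength d (k + 1) a).sum := by
  induction w with
  | nil => rfl
  | cons a w ih =>
    rw [List.flatMap_cons, List.map_append, List.sum_append, ih, List.map_cons, List.sum_cons]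
    congr 1
    unfold bonacciMorphism
    split_ifs with h <;> simp [iterLength, h]

theorem sum_iterLength_bonacciIter (d : ℕ) (hd : 2 ≤ d) (k m : ℕ) :
    ((bonacciIter d hd k).map fun a : Fin d => iterLength d m a).sum = iterLength d (k + m) 0 := by
  induction k generalizing m with
  | zero => simp [bonacciIter]
  | succ k ih =>
    rw [bonacciIter, sum_iterLength_flatMap, ih]
    congr 1
    omega

theorem length_bonacciIter (d : ℕ) (hd : 2 ≤ d) (k : ℕ) :
    (bonacciIter d hd k).length = bonacciNat d k := by
  rw [← iterLength_zero_eq_bonacciNat d hd, ← add_zero k, ← sum_iterLength_bonacciIter d hd]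
  simp [iterLength]

theorem IsBonacciWord.apply_zero {d : ℕ} {t : ℕ → Fin d} (ht : IsBonacciWord d t) :
    (t 0 : ℕ) = 0 := by
  have h := ht.apply_imageLength 0
  rwa [imageLength_zero] at h

theorem IsBonacciWord.bonacciIter_eq {d : ℕ} (hd : 2 ≤ d) {t : ℕ → Fin d}
    (ht : IsBonacciWord d t) (k : ℕ) :
    bonacciIter d hd k = wordFactor t (bonacciIter d hd k).length 0 := by
  induction k with
  | zero => simp [bonacciIter, wordFactor, Fin.ext_iff, ht.apply_zero]
  | succ k ih =>
    have h := ht (bonacciIter d hd k).length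
    rwa [← ih] at h

theorem IsBonacciWord.imageLength_bonacciNat {d : ℕ} (hd : 2 ≤ d) {t : ℕ → Fin d}
    (ht : IsBonacciWord d t) (k : ℕ) : imageLength t (bonacciNat d k) = bonacciNat d (k + 1) := by
  rw [← length_bonacciIter d hd k, ← length_bonacciIter d hd (k + 1), imageLength,
    ← ht.bonacciIter_eq hd k]
  rfl

theorem bonacciNat_zero (d : ℕ) (hd : 2 ≤ d) : bonacciNat d 0 = 1 := by
  rw [bonacciNat, if_pos (by omega), pow_zero]

theorem bonacciNat_strictMono (d : ℕ) (hd : 2 ≤ d) : StrictMono (bonacciNat d) := by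
  obtain ⟨t, ht, -⟩ := existsUnique_isBonacciWord d hd
  refine strictMono_nat_of_lt_succ fun k => ?_
  induction k with
  | zero => rw [bonacciNat_zero d hd, bonacciNat, if_pos (by omega)]; norm_num
  | succ k ih =>
    rw [← IsBonacciWord.imageLength_bonacciNat hd ht k,
      ← IsBonacciWord.imageLength_bonacciNat hd ht (k + 1)]
    exact imageLength_strictMono t ih

/-! ### Repetition and separation of factors. -/

/-- The claims need a joint induction: the first makes `imageLength` additive on `D_k + S_k =
S_{k+1}`, and the second gives the length of the next agreement. -/
theorem IsBonacciWord.bonacciNat_period {d : ℕ} (hd : 2 ≤ d) {t : ℕ → Fin d}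
    (ht : IsBonacciWord d t) (k : ℕ) :
    (∀ l < ∑ j ∈ Finset.range k, bonacciNat d j, t (bonacciNat d k + l) = t l) ∧
      imageLength t (∑ j ∈ Finset.range k, bonacciNat d j) + 1 =
        ∑ j ∈ Finset.range (k + 1), bonacciNat d j := by
  induction k with
  | zero => simp [imageLength_zero, bonacciNat_zero d hd]
  | succ k ih =>
    obtain ⟨h1, h2⟩ := ih
    refine ⟨fun l hl => ?_, ?_⟩
    · rw [← ht.imageLength_bonacciNat hd k]
      exact ht.apply_imageLength_add h1 (by omega)
    · have h3 := imageLength_add h1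
      rw [add_comm, ← Finset.sum_range_succ, ht.imageLength_bonacciNat hd] at h3
      rw [h3, Finset.sum_range_succ _ (k + 1)]
      omega

/-- Two occurrences of a factor in the `d`-bonacci word that cannot be extended to the left are
occurrences of a bispecial prefix of length `D_0 + ⋯ + D_{m-1}`. -/
theorem IsBonacciWord.exists_mismatch_of_left_maximal {d : ℕ} (hd : 2 ≤ d) {t : ℕ → Fin d}
    (ht : IsBonacciWord d t) (j i : ℕ) (hij : i < j)
    (hleft : i = 0 ∨ t (i - 1) ≠ t (j - 1)) :
    ∃ m, bonacciNat d m ≤ j ∧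
      (∀ l < ∑ r ∈ Finset.range m, bonacciNat d r, t (i + l) = t l ∧ t (j + l) = t l) ∧
      t (i + ∑ r ∈ Finset.range m, bonacciNat d r) ≠
        t (j + ∑ r ∈ Finset.range m, bonacciNat d r) := by
  induction j using Nat.strong_induction_on generalizing i with
  | _ j ih =>
    by_cases heq : t i = t j
    swap
    · exact ⟨0, by rw [bonacciNat_zero d hd]; omega, by simp, by simpa using heq⟩
    by_cases h0 : (t i : ℕ) = 0
    swap
    · exfalso
      obtain ⟨r, rfl, hr⟩ := ht.exists_of_apply_ne_zero h0
      obtain ⟨q, rfl, hq⟩ := ht.exists_of_apply_ne_zero (heq ▸ h0)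
      refine hleft.elim (by omega) fun h => h (Fin.ext ?_)
      simp [hr, hq]
    obtain ⟨i', rfl⟩ := ht.exists_of_apply_eq_zero h0
    obtain ⟨j', rfl⟩ := ht.exists_of_apply_eq_zero (heq ▸ h0)
    have hmono := imageLength_strictMono t
    have hij' : i' < j' := hmono.lt_iff_lt.1 hij
    -- The descent is strict because `τ(0)` has two letters.
    have hj' : j' < imageLength t j' := by
      obtain ⟨q, rfl⟩ := Nat.exists_eq_add_of_le' (show 1 ≤ j' by omega)
      have h1 : imageLength t 1 = 2 := by
        have := imageLength_succ t 0
        rwa [ht.apply_zero, if_pos (by omega), imageLength_zero] at this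
      have h2 := hmono.add_le_nat q 1
      omega
    -- Equal letters before the preimages would give equal last letters in the preceding blocks.
    have hleft' : i' = 0 ∨ t (i' - 1) ≠ t (j' - 1) := by
      by_contra! hcon
      obtain ⟨hi0, hlast⟩ := hcon
      obtain ⟨a, rfl⟩ := Nat.exists_eq_add_of_le' (show 1 ≤ i' by omega)
      obtain ⟨b, rfl⟩ := Nat.exists_eq_add_of_le' (show 1 ≤ j' by omega)
      have ha : 0 < imageLength t (a + 1) := by
        have := hmono.le_apply (x := a + 1)
        omega
      simp only [Nat.add_sub_cancel] at hlast
      refine hleft.elim (by omega) fun h => h (Fin.ext ?_)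
      rw [ht.apply_of_succ_eq_imageLength (m := a) (i := imageLength t (a + 1) - 1) (by omega),
        ht.apply_of_succ_eq_imageLength (m := b) (i := imageLength t (b + 1) - 1) (by omega),
        hlast]
    obtain ⟨m, hm1, hm2, hm3⟩ := ih j' hj' i' hij' hleft'
    have hS := (ht.bonacciNat_period hd m).2
    refine ⟨m + 1, ?_, fun l hl => ?_, ?_⟩
    · rw [← ht.imageLength_bonacciNat hd m]
      exact hmono.monotone hm1
    · exact ⟨ht.apply_imageLength_add (fun l hl => (hm2 l hl).1) (by omega),
        ht.apply_imageLength_add (fun l hl => (hm2 l hl).2) (by omega)⟩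
    -- Offset `S_{m+1}` is one past the start of the blocks of the mismatched letters `a ≠ b`. There
    -- stand `a + 1` and `b + 1` mod `d`, the value `0` opening the next block.
    · rw [← hS, ← add_assoc, ← add_assoc, ← imageLength_add fun l hl => (hm2 l hl).1,
        ← imageLength_add fun l hl => (hm2 l hl).2]
      intro h
      have h' := congrArg Fin.val h
      rw [ht.apply_imageLength_add_one, ht.apply_imageLength_add_one] at h'
      refine hm3 (Fin.ext ?_)
      split_ifs at h' <;> omega

/-- Sliding both positions left while the preceding letters agree reaches a left-maximal pair;
moving back only shortens the offset. -/
theorem IsBonacciWord.exists_mismatch {d : ℕ} (hd : 2 ≤ d) {t : ℕ → Fin d}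
    (ht : IsBonacciWord d t) (i j : ℕ) (hij : i < j) :
    ∃ m p, bonacciNat d m ≤ j ∧ p ≤ ∑ r ∈ Finset.range m, bonacciNat d r ∧
      t (i + p) ≠ t (j + p) := by
  induction i generalizing j with
  | zero =>
    obtain ⟨m, h1, -, h3⟩ := ht.exists_mismatch_of_left_maximal hd j 0 hij (Or.inl rfl)
    exact ⟨m, _, h1, le_rfl, h3⟩
  | succ i ih =>
    obtain ⟨j, rfl⟩ := Nat.exists_eq_add_of_le' (show 1 ≤ j by omega)
    by_cases h : t i = t j
    · obtain ⟨m, p, h1, h2, h3⟩ := ih j (by omega)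
      rcases p with _ | p
      · exact absurd h h3
      · refine ⟨m, p, by omega, by omega, ?_⟩
        rwa [add_right_comm i, add_right_comm j]
    · obtain ⟨m, h1, -, h3⟩ :=
        ht.exists_mismatch_of_left_maximal hd (j + 1) (i + 1) hij (Or.inr h)
      exact ⟨m, _, h1, le_rfl, h3⟩

theorem IsBonacciWord.initialNonrepetitiveComplexity_eq {d : ℕ} (hd : 2 ≤ d) {t : ℕ → Fin d}
    (ht : IsBonacciWord d t) {n k : ℕ} (hlower : ∑ j ∈ Finset.range k, bonacciNat d j < n)
    (hupper : n ≤ ∑ j ∈ Finset.range (k + 1), bonacciNat d j) :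
    initialNonrepetitiveComplexity t n = bonacciNat d (k + 1) := by
  refine (isGreatest_initialNonrepetitiveComplexity t n).unique ⟨?_, ?_⟩
  · intro i j hij hj heq
    rw [wordFactor_eq_iff] at heq
    obtain ⟨m, p, h1, h2, h3⟩ := ht.exists_mismatch hd i j hij
    have hm : m ≤ k := Nat.lt_succ_iff.1 ((bonacciNat_strictMono d hd).lt_iff_lt.1 (h1.trans_lt hj))
    have hle : ∑ r ∈ Finset.range m, bonacciNat d r ≤ ∑ r ∈ Finset.range k, bonacciNat d r :=
      Finset.sum_le_sum_of_subset (Finset.range_mono hm)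
    exact h3 (heq p (by omega))
  · intro m hm
    by_contra! hlt
    have hpos : 0 < bonacciNat d (k + 1) :=
      (Nat.zero_le _).trans_lt (bonacciNat_strictMono d hd (Nat.succ_pos k))
    refine hm 0 _ hpos hlt ((wordFactor_eq_iff _ _ _ _).2 fun l hl => ?_)
    rw [zero_add, (ht.bonacciNat_period hd (k + 1)).1 l (by omega)]

/-! ### Evaluation of the rational bounds. -/

theorem bonacciNumber_of_le (d : ℕ) {z : ℤ} (hz : z ≤ -2) : bonacciNumber d z = 0 := by
  obtain ⟨m, rfl⟩ : ∃ m : ℕ, z = Int.negSucc (m + 1) := ⟨(-z - 2).toNat, by omega⟩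
  rfl

theorem bonacciNumber_natCast (d k : ℕ) : bonacciNumber d (k : ℤ) = bonacciNat d k := rfl

/-- `D_{-1} = 1` extends the recurrence to all `k ≥ 0`: below `d` the term leaving the window is
zero, so the sum doubles. -/
theorem bonacciNumber_eq_sum (d : ℕ) (hd : 2 ≤ d) (k : ℕ) :
    ∑ i ∈ Finset.range d, bonacciNumber d ((k : ℤ) - i - 1) = bonacciNumber d k := by
  by_cases hk : d ≤ k
  · rw [bonacciNumber_natCast, bonacciNat, if_neg (by omega), Finset.sum_range]
    refine Finset.sum_congr rfl fun j _ => ?_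
    rw [show (k : ℤ) - (j : ℕ) - 1 = ((k - ((j : ℕ) + 1) : ℕ) : ℤ) by omega,
      bonacciNumber_natCast]
  · obtain ⟨e, rfl⟩ := Nat.exists_eq_add_of_le' (show 1 ≤ d by omega)
    induction k with
    | zero =>
      rw [Finset.sum_range_succ', Finset.sum_eq_zero fun i _ => bonacciNumber_of_le _ (by omega),
        bonacciNumber_natCast, bonacciNat_zero _ hd]
      rfl
    | succ k ih =>
      have ih' := ih (by omega)
      rw [Finset.sum_range_succ, bonacciNumber_of_le _ (by omega), add_zero] at ih'
      rw [Finset.sum_range_succ']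
      have hshift : ∀ i : ℕ, ((k + 1 : ℕ) : ℤ) - (i + 1 : ℕ) - 1 = (k : ℤ) - i - 1 := by
        intro i; omega
      simp only [hshift]
      rw [ih', show ((k + 1 : ℕ) : ℤ) - (0 : ℕ) - 1 = (k : ℤ) by omega]
      simp only [bonacciNumber_natCast]
      rw [bonacciNat, if_pos (by omega), bonacciNat, if_pos (by omega)]
      ring

/-- Passing to `k + 1` lowers each old weight by one, a loss of `D_k` by the recurrence, and adds
`D_k` with weight `d`: a net gain of `(d - 1) D_k`. At `k = 0` only `d D_{-1}` remains. -/
theorem weighted_sum_bonacciNumber (d : ℕ) (hd : 2 ≤ d) (k : ℕ) :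
    ∑ i ∈ Finset.range d, ((d : ℚ) - (i : ℚ)) * (bonacciNumber d ((k : ℤ) - (i : ℤ) - 1) : ℚ) =
      ((d : ℚ) - 1) * (∑ j ∈ Finset.range k, bonacciNat d j : ℕ) + d := by
  obtain ⟨e, rfl⟩ := Nat.exists_eq_add_of_le' (show 1 ≤ d by omega)
  induction k with
  | zero =>
    rw [Finset.sum_range_succ', Finset.sum_eq_zero fun i _ => by
      rw [bonacciNumber_of_le _ (by omega)]; simp]
    have h : bonacciNumber (e + 1) (-1) = 1 := rfl
    simp [h]
  | succ k ih =>
    have hrec : ∑ i ∈ Finset.range (e + 1),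
        (bonacciNumber (e + 1) ((k : ℤ) - (i : ℤ) - 1) : ℚ) = bonacciNat (e + 1) k := by
      exact_mod_cast bonacciNumber_eq_sum (e + 1) hd k
    have hshift : ∀ i : ℕ, ((k + 1 : ℕ) : ℤ) - (i + 1 : ℕ) - 1 = (k : ℤ) - i - 1 := by
      intro i; omega
    have hsub : ∑ i ∈ Finset.range (e + 1), (((e + 1 : ℕ) : ℚ) - ((i + 1 : ℕ) : ℚ)) *
        (bonacciNumber (e + 1) ((k : ℤ) - (i : ℤ) - 1) : ℚ) =
        ((((e + 1 : ℕ) : ℚ) - 1) * (∑ j ∈ Finset.range k, bonacciNat (e + 1) j : ℕ) +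
          (e + 1 : ℕ)) - bonacciNat (e + 1) k := by
      rw [← ih, ← hrec, ← Finset.sum_sub_distrib]
      refine Finset.sum_congr rfl fun i _ => ?_
      push_cast
      ring
    rw [Finset.sum_range_succ, sub_self, zero_mul, add_zero] at hsub
    rw [Finset.sum_range_succ']
    simp only [hshift]
    rw [hsub, show ((k + 1 : ℕ) : ℤ) - (0 : ℕ) - 1 = (k : ℤ) by omega, bonacciNumber_natCast,
      Finset.sum_range_succ]
    push_cast
    ring

theorem theorem21 (d : ℕ) (hd : 2 ≤ d) (t : ℕ → Fin d) (ht : IsBonacciWord d t)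
    (n k : ℕ) (hn : 0 < n) (hk : 0 < k)
    (hlower : 1 / ((d : ℚ) - 1) *
        ∑ i ∈ Finset.range d, ((d : ℚ) - (i : ℚ)) *
          (bonacciNumber d ((k : ℤ) - (i : ℤ) - 2) : ℚ)
        - (d : ℚ) / ((d : ℚ) - 1) < (n : ℚ))
    (hupper : (n : ℚ) ≤ 1 / ((d : ℚ) - 1) *
        ∑ i ∈ Finset.range d, ((d : ℚ) - (i : ℚ)) *
          (bonacciNumber d ((k : ℤ) - (i : ℤ) - 1) : ℚ)
        - (d : ℚ) / ((d : ℚ) - 1)) :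
    initialNonrepetitiveComplexity t n = bonacciNumber d (k : ℤ) := by
  obtain ⟨k, rfl⟩ := Nat.exists_eq_add_of_le' hk
  have hd1 : (d : ℚ) - 1 ≠ 0 := by
    have : (2 : ℚ) ≤ d := by exact_mod_cast hd
    linarith
  have hbound : ∀ x : ℚ, 1 / ((d : ℚ) - 1) * (((d : ℚ) - 1) * x + d) - d / ((d : ℚ) - 1) = x := by
    intro x
    field_simp
    ring
  have hshift : ∀ i : ℕ, ((k + 1 : ℕ) : ℤ) - (i : ℤ) - 2 = (k : ℤ) - i - 1 := by
    intro i; omega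
  simp only [hshift] at hlower
  rw [weighted_sum_bonacciNumber d hd, hbound] at hlower hupper
  exact ht.initialNonrepetitiveComplexity_eq hd (by exact_mod_cast hlower)
    (by exact_mod_cast hupper)
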